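/- All metrics take finite values. For a metric space $X$ let $\overline X$ be its metric completion and $\partial X:=\overline X\setminus X$. A metric space is called noncomplete if it is not complete, and precompact if it is totally bounded. For noncomplete precompact metric spaces $X,Y$ put $$d_{GHB}(X,Y):=\inf\bigl(d_H^Z(\varphi(X),\psi(Y))+d_H^Z(\varphi(\partial X),\psi(\partial Y))\bigr),$$ where $d_H^Z$ is the Hausdorff distance in $Z$ and the infimum is over all metric spaces $Z$ and all isometric (distance-preserving) embeddings $\varphi:\overline X\to Z$, $\psi:\overline Y\to Z$. Let $\mathcal M$ be the class of all noncomplete, precompact, locally compact metric spaces, where two spaces are identified if there is a bijective isometry between them. Let $A>0$. A metric space $\Omega$ is called $A$-uniform if it is noncomplete, locally compact, any two of its points can be joined by a curve of finite length, and for all $x,y\in\Omega$ there is a continuous curve $\gamma:[0,1]\to\Omega$ from $x$ to $y$ whose length satisfies $\ell(\gamma)\le A\,d(x,y)$ and for which $$\min\{\ell(\gamma|_{[0,t]}),\ell(\gamma|_{[t,1]})\}\le A\,\operatorname{dist}(\gamma(t),\partial\Omega)\qquad\text{for all }t\in[0,1].$$ For $A>0$ and $R>0$ let $\mathcal U(A,R)$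 be the class of all bounded $A$-uniform spaces $\Omega$ with $\operatorname{diam}\Omega\ge R$, up to isometry. Theorem. (1) $d_{GHB}$ is well defined on $\mathcal M$, takes finite values there and is a metric on $\mathcal M$; the metric space $(\mathcal M,d_{GHB})$ is not complete. (2) For all $A>0$ and $R>0$, every space belonging to $\mathcal U(A,R)$ is precompact, so that $\mathcal U(A,R)\subseteq\mathcal M$, and $(\mathcal U(A,R),d_{GHB})$ is a complete metric space. -/

import Mathlib

universe u

noncomputable section

namespace GHB

open Set UniformSpace

/-- A noncomplete, precompact (that is, totally bounded), locally compact metric space. -/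
structure IsNoncompletePrecompactLocallyCompact (X : Type u) [MetricSpace X] : Prop where
  not_complete : ¬ CompleteSpace X
  precompact : TotallyBounded (univ : Set X)
  locallyCompact : LocallyCompactSpace X

/-- The copy of `X` inside its metric completion. -/
def copy (X : Type u) [MetricSpace X] : Set (Completion X) :=
  range ((↑) : X → Completion X)

/-- The metric boundary `∂X`: the metric completion of `X` minus `X`. -/
def boundary (X : Type u) [MetricSpace X] : Set (Completion X) :=
  (copy X)ᶜ

/-- The Gromov–Hausdorff distance with boundary. It is valued in `[0, ∞]`, so that no convention
about infinite Hausdorff distances enters; the infimum is over all metric spaces `Z` and all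
distance-preserving maps of the two completions into `Z`. -/
def ghbDist (X Y : Type u) [MetricSpace X] [MetricSpace Y] : ENNReal :=
  ⨅ (Z : Type u) (_ : MetricSpace Z) (φ : Completion X → Z) (ψ : Completion Y → Z)
    (_ : Isometry φ) (_ : Isometry ψ),
    Metric.hausdorffEDist (φ '' copy X) (ψ '' copy Y) +
      Metric.hausdorffEDist (φ '' boundary X) (ψ '' boundary Y)

/-- A noncomplete precompact locally compact metric space, bundled with its metric. -/
structure Space : Type (u + 1) where
  carrier : Type u
  [metric : MetricSpace carrier]
  prop : IsNoncompletePrecompactLocallyCompact carrier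

attribute [instance] Space.metric

/-- Two spaces are equivalent when there is a bijective isometry between them. -/
instance isometrySetoid : Setoid Space.{u} where
  r X Y := Nonempty (X.carrier ≃ᵢ Y.carrier)
  iseqv :=
    { refl := fun X => ⟨IsometryEquiv.refl X.carrier⟩
      symm := fun ⟨e⟩ => ⟨e.symm⟩
      trans := fun ⟨e⟩ ⟨f⟩ => ⟨e.trans f⟩ }

/-- The class `𝓜` of all noncomplete precompact locally compact metric spaces up to isometry. -/
def IsometryClass : Type (u + 1) :=
  Quotient isometrySetoid.{u}

/-- The isometry class of a space. -/
def Space.toClass (X : Space.{u}) : IsometryClass.{u} :=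
  Quotient.mk isometrySetoid X

/-- The restriction of `γ` to `[0, 1]` is a curve from `x` to `y`. -/
structure IsCurve {X : Type u} [MetricSpace X] (γ : ℝ → X) (x y : X) : Prop where
  continuousOn : ContinuousOn γ (Icc 0 1)
  source : γ 0 = x
  target : γ 1 = y

/-- The length in `[0, ∞]` of the restriction of `γ` to `[a, b]`. -/
def length {X : Type u} [MetricSpace X] (γ : ℝ → X) (a b : ℝ) : ENNReal :=
  eVariationOn γ (Icc a b)

/-- `γ` restricted to `[0, 1]` is an `A`-uniform curve from `x` to `y`. -/
structure IsUniformCurve (A : ℝ) {X : Type u} [MetricSpace X] (γ : ℝ → X) (x y : X) : Prop where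
  isCurve : IsCurve γ x y
  length_le : length γ 0 1 ≤ ENNReal.ofReal (A * dist x y)
  min_length_le : ∀ t ∈ Icc (0 : ℝ) 1,
    min (length γ 0 t) (length γ t 1) ≤
      ENNReal.ofReal A * Metric.infEDist (γ t : Completion X) (boundary X)

/-- `A`-uniform spaces. -/
structure IsUniformSpace (A : ℝ) (X : Type u) [MetricSpace X] : Prop where
  locallyCompact : LocallyCompactSpace X
  rectifiablyConnected : ∀ x y : X, ∃ γ : ℝ → X, IsCurve γ x y ∧ length γ 0 1 < ⊤
  not_complete : ¬ CompleteSpace X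
  exists_uniformCurve : ∀ x y : X, ∃ γ : ℝ → X, IsUniformCurve A γ x y

/-- Bounded `A`-uniform spaces of diameter at least `R`. -/
structure IsBoundedUniform (A R : ℝ) (X : Type u) [MetricSpace X] : Prop where
  isUniformSpace : IsUniformSpace A X
  bounded : Bornology.IsBounded (univ : Set X)
  le_diam : R ≤ Metric.diam (univ : Set X)

/-- The set `𝓤(A, R) ⊆ 𝓜` of isometry classes of bounded `A`-uniform spaces of diameter at
least `R`. -/
def uniformClass (A R : ℝ) : Set IsometryClass.{u} :=
  {c | ∃ X : Space.{u}, X.toClass = c ∧ IsBoundedUniform A R X.carrier}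

end GHB

end

/-! Optimal ambient spaces are never needed: a bound on `ghbDist` is used through some ambient space
`Z` in which the two completions are placed almost optimally.

*Metric.* The triangle inequality comes from gluing two ambient spaces along the completion of the
middle space (`ghbDist_triangle`), and finiteness from gluing two completions at a point
(`ghbDist_le_of_edist_le`). If the distance of `X` and `Y` is zero, ambient spaces with error tending
to zero give approximate isometries between the compact completions, in both directions and
respecting the boundaries; their pointwise limits along an ultrafilter are mutually inverse
isometries (`nonempty_isometryEquiv_of_ghbDist_eq_zero`). The metric is not complete because the
intervals `(0, 1 / n)` form a Cauchy sequence that shrinks to a point, and a point is complete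
(`not_completeSpace_isometryClass`).

*Precompactness.* A rectifiable curve can be parametrized proportionally to arc length, which turns
a uniform curve into a Lipschitz map with an explicit lower bound for the distance to the boundary
(`IsUniformArc`). By a Hopf–Rinow argument the points that can be reached by curves of bounded length
staying at a fixed distance from the boundary form a totally bounded set
(`totallyBounded_reachable`). In a bounded uniform space all points at distance at least `ε` from
the boundary can be so reached from one of them (`IsUniformArc.le_infDist`), and every point is
within `A * ε` of such points: follow a uniform arc to a remote point for the length `A * ε`
(`IsUniformArc.exists_le_infDist`).

*Completeness.* A rapidly converging sequence of uniform spaces is realized in one complete space by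
successive gluing (`exists_common_space`). The completions and the boundaries converge there to
compact sets `K` and `B` in the Hausdorff distance. Uniform arcs are uniformly Lipschitz, so they
have pointwise limits along an ultrafilter, which are uniform arcs with the same constant
(`exists_isUniformArc_limit`). Such arcs avoid `B` if their end points do, and they show that `K \ B`
is dense in `K`; the lower bound on the diameter keeps the scale at which this works from shrinking
to zero. So `K \ B` is a bounded uniform space with completion `K` and boundary `B`
(`exists_space_of_isUniformArc`), and it is the limit of the sequence. -/

noncomputable section

namespace GHB

open Set UniformSpace Metric Filter Topology
open scoped ENNReal

/-! ### The completion and the metric boundary -/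

section Boundary

variable {X Y : Type u} [MetricSpace X] [MetricSpace Y]

theorem boundary_nonempty (h : ¬ CompleteSpace X) : (boundary X).Nonempty := by
  by_contra hne
  rw [not_nonempty_iff_eq_empty, boundary, compl_empty_iff] at hne
  exact h ((Completion.isUniformEmbedding_coe X).isUniformInducing.completeSpace_congr
    (range_eq_univ.1 hne) |>.2 inferInstance)

/-- A dense locally compact subspace of a Hausdorff space is open. -/
theorem isOpen_copy [LocallyCompactSpace X] : IsOpen (copy X) := by
  rw [isOpen_iff_mem_nhds]
  rintro _ ⟨x, rfl⟩
  obtain ⟨K, hK, hx⟩ := exists_compact_mem_nhds x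
  rw [(Completion.isUniformEmbedding_coe X).isEmbedding.isInducing.nhds_eq_comap, mem_comap] at hx
  obtain ⟨V, hV, hVK⟩ := hx
  obtain ⟨U, hUV, hU, hxU⟩ := _root_.mem_nhds_iff.1 hV
  have hcl : IsClosed ((↑) '' K : Set (Completion X)) :=
    (hK.image (Completion.continuous_coe X)).isClosed
  refine _root_.mem_nhds_iff.2 ⟨U, fun p hp => ?_, hU, hxU⟩
  have h1 : p ∈ closure (U ∩ copy X) :=
    (Completion.denseRange_coe (α := X)).open_subset_closure_inter hU hp
  have h2 : U ∩ copy X ⊆ (↑) '' K := by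
    rintro _ ⟨hq, z, rfl⟩
    exact ⟨z, hVK (hUV hq), rfl⟩
  exact image_subset_range _ _ (closure_minimal h2 hcl h1)

theorem isClosed_boundary [LocallyCompactSpace X] : IsClosed (boundary X) :=
  isOpen_copy.isClosed_compl

theorem compactSpace_completion (h : TotallyBounded (univ : Set X)) :
    CompactSpace (Completion X) := by
  have h1 : TotallyBounded (closure (range ((↑) : X → Completion X))) := by
    rw [← image_univ]
    exact (h.image (Completion.uniformContinuous_coe X)).closure
  rw [Completion.denseRange_coe.closure_range] at h1
  exact ⟨isCompact_iff_totallyBounded_isComplete.2 ⟨h1, isClosed_univ.isComplete⟩⟩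

/-- An isometry into a complete space extends to the completion; the image of the boundary consists
of the points that have to be added to the range to make it closed. -/
theorem exists_isometry_completion {W : Type*} [MetricSpace W] [CompleteSpace W] {ι : X → W}
    (hι : Isometry ι) : ∃ φ : Completion X → W, Isometry φ ∧ (∀ x : X, φ x = ι x) ∧
      φ '' copy X = range ι ∧ φ '' boundary X = closure (range ι) \ range ι := by
  have hφ := hι.completion_extension
  have hc : ∀ x : X, Completion.extension ι (x : Completion X) = ι x :=
    Completion.extension_coe hι.uniformContinuous
  have hcopy : Completion.extension ι '' copy X = range ι := by
    rw [copy, ← range_comp]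
    exact congrArg range (funext hc)
  refine ⟨_, hφ, hc, hcopy, ?_⟩
  have hrange : range (Completion.extension ι) = closure (range ι) := by
    apply subset_antisymm
    · rw [← hcopy, ← image_univ, ← Completion.denseRange_coe.closure_range]
      exact image_closure_subset_closure_image hφ.continuous
    · refine closure_minimal ?_ hφ.isClosedEmbedding.isClosed_range
      rw [← hcopy]
      exact image_subset_range _ _
  rw [boundary, image_compl_eq_range_sdiff_image hφ.injective, hrange, hcopy]

theorem infEDist_boundary_ne_top (h : ¬ CompleteSpace X) (x : Completion X) :
    infEDist x (boundary X) ≠ ∞ :=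
  infEDist_ne_top (boundary_nonempty h)

end Boundary

namespace Space

variable (X : Space.{u})

instance : LocallyCompactSpace X.carrier := X.prop.locallyCompact

instance : CompactSpace (Completion X.carrier) := compactSpace_completion X.prop.precompact

theorem boundary_nonempty : (boundary X.carrier).Nonempty :=
  GHB.boundary_nonempty X.prop.not_complete

instance : Nonempty X.carrier := by
  by_contra h
  rw [not_nonempty_iff] at h
  exact X.prop.not_complete inferInstance

instance : Nonempty (Completion X.carrier) := (inferInstance : Nonempty X.carrier).map (↑)

theorem copy_nonempty : (copy X.carrier).Nonempty := range_nonempty _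

end Space

/-! ### The Gromov–Hausdorff distance with boundary is a metric -/

section Dist

variable {X Y : Type u} [MetricSpace X] [MetricSpace Y]

theorem ghbDist_le {Z : Type u} [MetricSpace Z] {φ : Completion X → Z} {ψ : Completion Y → Z}
    (hφ : Isometry φ) (hψ : Isometry ψ) :
    ghbDist X Y ≤ hausdorffEDist (φ '' copy X) (ψ '' copy Y) +
      hausdorffEDist (φ '' boundary X) (ψ '' boundary Y) :=
  iInf_le_of_le Z <| iInf_le_of_le _ <| iInf_le_of_le φ <| iInf_le_of_le ψ <|
    iInf_le_of_le hφ <| iInf_le _ hψ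

theorem exists_of_ghbDist_lt {r : ℝ≥0∞} (h : ghbDist X Y < r) :
    ∃ (Z : Type u) (_ : MetricSpace Z) (φ : Completion X → Z) (ψ : Completion Y → Z),
      Isometry φ ∧ Isometry ψ ∧ hausdorffEDist (φ '' copy X) (ψ '' copy Y) +
        hausdorffEDist (φ '' boundary X) (ψ '' boundary Y) < r := by
  simp only [ghbDist, iInf_lt_iff] at h
  obtain ⟨Z, hZ, φ, ψ, hφ, hψ, h⟩ := h
  exact ⟨Z, hZ, φ, ψ, hφ, hψ, h⟩

theorem ghbDist_comm_le : ghbDist X Y ≤ ghbDist Y X := by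
  refine le_of_forall_gt fun r hr => ?_
  obtain ⟨Z, _, φ, ψ, hφ, hψ, h⟩ := exists_of_ghbDist_lt hr
  refine (ghbDist_le hψ hφ).trans_lt ?_
  rwa [hausdorffEDist_comm, hausdorffEDist_comm (s := ψ '' boundary X)]

theorem ghbDist_comm : ghbDist X Y = ghbDist Y X :=
  le_antisymm ghbDist_comm_le ghbDist_comm_le

/-- Two ambient spaces can be glued along the completion of the middle space. -/
theorem ghbDist_triangle {V : Type u} [MetricSpace V] [Nonempty Y] :
    ghbDist X V ≤ ghbDist X Y + ghbDist Y V := by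
  have : Nonempty (Completion Y) := ‹Nonempty Y›.map (↑)
  refine ENNReal.le_of_forall_pos_le_add fun ε hε hfin => ?_
  obtain ⟨h1, h2⟩ := ENNReal.add_lt_top.1 hfin
  have hε2 : (ε / 2 : ℝ≥0∞) ≠ 0 := by simpa using hε.ne'
  obtain ⟨Z, _, φ, ψ, hφ, hψ, hZ⟩ := exists_of_ghbDist_lt (ENNReal.lt_add_right h1.ne hε2)
  obtain ⟨Z', _, φ', ψ', hφ', hψ', hZ'⟩ := exists_of_ghbDist_lt (ENNReal.lt_add_right h2.ne hε2)
  have hL := toGlueL_isometry hψ hφ'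
  have hR := toGlueR_isometry hψ hφ'
  have key : ∀ (s : Set (Completion X)) (t : Set (Completion Y)) (r : Set (Completion V)),
      hausdorffEDist ((toGlueL hψ hφ' ∘ φ) '' s) ((toGlueR hψ hφ' ∘ ψ') '' r) ≤
        hausdorffEDist (φ '' s) (ψ '' t) + hausdorffEDist (φ' '' t) (ψ' '' r) := by
    intro s t r
    rw [← hausdorffEDist_image hL, ← hausdorffEDist_image (s := φ' '' t) hR]
    simp only [← image_comp]
    rw [← toGlue_commute hψ hφ']
    exact hausdorffEDist_triangle
  calc ghbDist X V ≤ _ := ghbDist_le (hL.comp hφ) (hR.comp hψ')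
    _ ≤ _ := add_le_add (key _ (copy Y) _) (key _ (boundary Y) _)
    _ ≤ (ghbDist X Y + ε / 2) + (ghbDist Y V + ε / 2) := by
      rw [add_add_add_comm]
      exact add_le_add hZ.le hZ'.le
    _ = _ := by rw [add_add_add_comm, ENNReal.add_halves]

theorem ghbDist_eq_zero_of_isometryEquiv (e : X ≃ᵢ Y) : ghbDist X Y = 0 := by
  have hι : Isometry (fun x => (e x : Completion Y)) := Completion.coe_isometry.comp e.isometry
  obtain ⟨φ, hφ, -, hcopy, hbd⟩ := exists_isometry_completion hι
  have hr : range (fun x => (e x : Completion Y)) = copy Y :=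
    e.surjective.range_comp ((↑) : Y → Completion Y)
  have hcl : closure (copy Y) = univ := Completion.denseRange_coe.closure_range
  refine le_antisymm ((ghbDist_le hφ isometry_id).trans ?_) zero_le
  rw [hcopy, hbd, hr, hcl, image_id, image_id, ← compl_eq_univ_sdiff]
  simp [boundary]

/-- Two spaces of small diameter are close: glue their completions at a point. -/
theorem ghbDist_le_of_edist_le {C : ℝ≥0∞} (hX : ∀ x y : Completion X, edist x y ≤ C)
    (hY : ∀ x y : Completion Y, edist x y ≤ C) [Nonempty X] [Nonempty Y]
    (hbX : (boundary X).Nonempty) (hbY : (boundary Y).Nonempty) :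
    ghbDist X Y ≤ 4 * C := by
  obtain ⟨x₀⟩ := ‹Nonempty X›
  obtain ⟨y₀⟩ := ‹Nonempty Y›
  have hΦ : Isometry (fun _ : PUnit.{1} => (x₀ : Completion X)) := fun _ _ => by simp
  have hΨ : Isometry (fun _ : PUnit.{1} => (y₀ : Completion Y)) := fun _ _ => by simp
  have hL := toGlueL_isometry hΦ hΨ
  have hR := toGlueR_isometry hΦ hΨ
  have h0 : toGlueL hΦ hΨ (x₀ : Completion X) = toGlueR hΦ hΨ (y₀ : Completion Y) :=
    congrFun (toGlue_commute hΦ hΨ) PUnit.unit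
  have hd : ∀ (x : Completion X) (y : Completion Y),
      edist (toGlueL hΦ hΨ x) (toGlueR hΦ hΨ y) ≤ 2 * C := by
    intro x y
    refine (edist_triangle _ (toGlueL hΦ hΨ (x₀ : Completion X)) _).trans ?_
    rw [hL.edist_eq, h0, hR.edist_eq, two_mul]
    exact add_le_add (hX _ _) (hY _ _)
  have key : ∀ (s : Set (Completion X)) (t : Set (Completion Y)), s.Nonempty → t.Nonempty →
      hausdorffEDist (toGlueL hΦ hΨ '' s) (toGlueR hΦ hΨ '' t) ≤ 2 * C := by
    rintro s t ⟨a, ha⟩ ⟨b, hb⟩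
    apply hausdorffEDist_le_of_mem_edist
    · rintro _ ⟨x, -, rfl⟩
      exact ⟨_, mem_image_of_mem _ hb, hd _ _⟩
    · rintro _ ⟨y, -, rfl⟩
      exact ⟨_, mem_image_of_mem _ ha, by rw [edist_comm]; exact hd _ _⟩
  calc ghbDist X Y ≤ _ := ghbDist_le hL hR
    _ ≤ 2 * C + 2 * C := add_le_add (key _ _ ⟨_, mem_range_self x₀⟩ ⟨_, mem_range_self y₀⟩)
        (key _ _ hbX hbY)
    _ = 4 * C := by rw [← add_mul]; norm_num

end Dist

theorem ghbDist_ne_top (X Y : Space.{u}) : ghbDist X.carrier Y.carrier ≠ ∞ := by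
  have hb : ∀ X : Space.{u}, ∃ C : ℝ≥0∞, C ≠ ∞ ∧ ∀ x y : Completion X.carrier, edist x y ≤ C :=
    fun X => ⟨_, (isCompact_univ (X := Completion X.carrier)).isBounded.ediam_ne_top,
      fun x y => edist_le_ediam_of_mem (mem_univ x) (mem_univ y)⟩
  obtain ⟨C, hC, hX⟩ := hb X
  obtain ⟨D, hD, hY⟩ := hb Y
  refine ne_top_of_le_ne_top ?_ (ghbDist_le_of_edist_le (C := max C D)
    (fun x y => (hX x y).trans (le_max_left _ _)) (fun x y => (hY x y).trans (le_max_right _ _))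
    X.boundary_nonempty Y.boundary_nonempty)
  exact ENNReal.mul_ne_top (by simp) (max_lt hC.lt_top hD.lt_top).ne

/-- If the distance of `x` to `f n x` and of `f n x` to `g n (f n x)` tends to zero, measured in
ambient spaces that depend on `n`, then the limits of the approximate maps are inverse to each
other. -/
theorem leftInverse_of_tendsto_approx {P Q : Type u} [MetricSpace P] [MetricSpace Q]
    {U : Filter ℕ} [U.NeBot] {Z : ℕ → Type u} [∀ n, MetricSpace (Z n)]
    {φ : ∀ n, P → Z n} {ψ : ∀ n, Q → Z n} (hφ : ∀ n, Isometry (φ n)) (hψ : ∀ n, Isometry (ψ n))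
    {δ : ℕ → ℝ≥0∞} (hδ : Tendsto δ U (𝓝 0)) {f : ℕ → P → Q} {g : ℕ → Q → P}
    (hf : ∀ n x, edist (φ n x) (ψ n (f n x)) ≤ δ n)
    (hg : ∀ n y, edist (φ n (g n y)) (ψ n y) ≤ δ n)
    {F : P → Q} {G : Q → P} (hF : ∀ x, Tendsto (fun n => f n x) U (𝓝 (F x)))
    (hG : ∀ y, Tendsto (fun n => g n y) U (𝓝 (G y))) (x : P) : G (F x) = x := by
  refine tendsto_nhds_unique (hG (F x)) (tendsto_iff_edist_tendsto_0.2 ?_)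
  have hlim : Tendsto (fun n => δ n + edist (F x) (f n x) + δ n) U (𝓝 0) := by
    have h1 := tendsto_iff_edist_tendsto_0.1 (hF x)
    simp_rw [edist_comm (f _ x)] at h1
    simpa using (hδ.add h1).add hδ
  refine tendsto_of_tendsto_of_tendsto_of_le_of_le tendsto_const_nhds hlim (fun _ => zero_le)
    fun n => ?_
  rw [← (hφ n).edist_eq]
  refine (edist_triangle4 _ (ψ n (F x)) (ψ n (f n x)) _).trans ?_
  rw [(hψ n).edist_eq]
  refine add_le_add (add_le_add (hg _ _) le_rfl) ?_
  rw [edist_comm]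
  exact hf n x

/-- The pointwise limit of maps `f n` such that `f n x` is uniformly close to `x`, measured in
ambient spaces that depend on `n`, is an isometry. -/
theorem isometry_of_tendsto_approx {P Q : Type u} [MetricSpace P] [MetricSpace Q]
    {U : Filter ℕ} [U.NeBot] {Z : ℕ → Type u} [∀ n, MetricSpace (Z n)]
    {φ : ∀ n, P → Z n} {ψ : ∀ n, Q → Z n} (hφ : ∀ n, Isometry (φ n)) (hψ : ∀ n, Isometry (ψ n))
    {δ : ℕ → ℝ≥0∞} (hδ : Tendsto δ U (𝓝 0)) {f : ℕ → P → Q}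
    (hf : ∀ n x, edist (φ n x) (ψ n (f n x)) ≤ δ n)
    {F : P → Q} (hF : ∀ x, Tendsto (fun n => f n x) U (𝓝 (F x))) : Isometry F := by
  intro x y
  have hlim : Tendsto (fun n => edist (f n x) (f n y)) U (𝓝 (edist (F x) (F y))) :=
    (hF x).edist (hF y)
  apply le_antisymm
  · have h2 : Tendsto (fun n => δ n + edist x y + δ n) U (𝓝 (edist x y)) := by
      simpa using (hδ.add (tendsto_const_nhds (x := edist x y))).add hδ
    refine le_of_tendsto_of_tendsto' hlim h2 fun n => ?_
    rw [← (hψ n).edist_eq, ← (hφ n).edist_eq]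
    refine (edist_triangle4 _ (φ n x) (φ n y) _).trans ?_
    gcongr
    · rw [edist_comm]; exact hf n x
    · exact hf n y
  · have h2 : Tendsto (fun n => δ n + edist (f n x) (f n y) + δ n) U (𝓝 (edist (F x) (F y))) := by
      simpa using (hδ.add hlim).add hδ
    refine le_of_tendsto_of_tendsto' tendsto_const_nhds h2 fun n => ?_
    rw [← (hψ n).edist_eq, ← (hφ n).edist_eq]
    refine (edist_triangle4 _ (ψ n (f n x)) (ψ n (f n y)) _).trans ?_
    gcongr
    · exact hf n x
    · rw [edist_comm]; exact hf n y

/-- Points of `X̄` have near points in `Ȳ` on the same side of the boundary. -/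
theorem exists_approx {X Y : Type u} [MetricSpace X] [MetricSpace Y] {Z : Type u} [MetricSpace Z]
    {φ : Completion X → Z} {ψ : Completion Y → Z} {δ : ℝ≥0∞}
    (h : hausdorffEDist (φ '' copy X) (ψ '' copy Y) +
      hausdorffEDist (φ '' boundary X) (ψ '' boundary Y) < δ) (x : Completion X) :
    ∃ y, edist (φ x) (ψ y) ≤ δ ∧ (x ∈ boundary X → y ∈ boundary Y) := by
  by_cases hx : x ∈ boundary X
  · obtain ⟨_, ⟨y, hy, rfl⟩, hd⟩ := exists_edist_lt_of_hausdorffEDist_lt (mem_image_of_mem φ hx)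
      (le_add_self.trans_lt h)
    exact ⟨y, hd.le, fun _ => hy⟩
  · obtain ⟨_, ⟨y, hy, rfl⟩, hd⟩ := exists_edist_lt_of_hausdorffEDist_lt
      (mem_image_of_mem φ (not_notMem.1 hx)) (le_self_add.trans_lt h)
    exact ⟨y, hd.le, fun h => absurd h hx⟩

theorem exists_tendsto_ultrafilter {Q : Type*} [TopologicalSpace Q] [CompactSpace Q]
    (U : Ultrafilter ℕ) (q : ℕ → Q) : ∃ a, Tendsto q U (𝓝 a) := by
  obtain ⟨a, -, ha⟩ := isCompact_univ.ultrafilter_le_nhds (U.map q) (by simp)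
  exact ⟨a, ha⟩

/-- Spaces at distance zero are isometric: limits along an ultrafilter of approximate isometries
between the compact completions are mutually inverse isometries that respect the boundaries. -/
theorem nonempty_isometryEquiv_of_ghbDist_eq_zero (X Y : Space.{u})
    (h : ghbDist X.carrier Y.carrier = 0) : Nonempty (X.carrier ≃ᵢ Y.carrier) := by
  set δ : ℕ → ℝ≥0∞ := fun n => ((n : ℝ≥0∞) + 1)⁻¹ with hδdef
  have hδpos : ∀ n, 0 < δ n := fun n => by simp [hδdef]
  have hδ : Tendsto δ atTop (𝓝 0) := by
    have := (tendsto_add_atTop_iff_nat 1).2 ENNReal.tendsto_inv_nat_nhds_zero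
    simpa [hδdef] using this
  have hZ : ∀ n, ghbDist X.carrier Y.carrier < δ n := fun n => by rw [h]; exact hδpos n
  choose Z _ φ ψ hφ hψ hd using fun n => exists_of_ghbDist_lt (hZ n)
  have hd' : ∀ n, hausdorffEDist (ψ n '' copy Y.carrier) (φ n '' copy X.carrier) +
      hausdorffEDist (ψ n '' boundary Y.carrier) (φ n '' boundary X.carrier) < δ n := fun n => by
    rw [hausdorffEDist_comm, hausdorffEDist_comm (s := ψ n '' boundary _)]
    exact hd n
  choose f hf hfb using fun n => exists_approx (hd n)
  choose g hg hgb using fun n => exists_approx (hd' n)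
  have hg' : ∀ n y, edist (φ n (g n y)) (ψ n y) ≤ δ n := fun n y => by
    rw [edist_comm]; exact hg n y
  have hf' : ∀ n y, edist (ψ n (f n y)) (φ n y) ≤ δ n := fun n y => by
    rw [edist_comm]; exact hf n y
  let U : Ultrafilter ℕ := Ultrafilter.of atTop
  have hU : (U : Filter ℕ) ≤ atTop := Ultrafilter.of_le _
  choose F hF using fun x => exists_tendsto_ultrafilter U fun n => f n x
  choose G hG using fun y => exists_tendsto_ultrafilter U fun n => g n y
  have hδU := hδ.mono_left hU
  have hFi : Isometry F := isometry_of_tendsto_approx hφ hψ hδU hf hF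
  have hGF := leftInverse_of_tendsto_approx hφ hψ hδU hf hg' hF hG
  have hFG := leftInverse_of_tendsto_approx hψ hφ hδU hg hf' hG hF
  have hFb : ∀ x ∈ boundary X.carrier, F x ∈ boundary Y.carrier := fun x hx =>
    isClosed_boundary.mem_of_tendsto (hF x) (Eventually.of_forall fun n => hfb n x hx)
  have hGb : ∀ y ∈ boundary Y.carrier, G y ∈ boundary X.carrier := fun y hy =>
    isClosed_boundary.mem_of_tendsto (hG y) (Eventually.of_forall fun n => hgb n y hy)
  have hFc : ∀ x : X.carrier, ∃ y : Y.carrier, (y : Completion Y.carrier) = F x := fun x => by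
    by_contra hx
    have := hGb _ hx
    rw [hGF] at this
    exact this ⟨x, rfl⟩
  have hGc : ∀ y : Y.carrier, ∃ x : X.carrier, (x : Completion X.carrier) = G y := fun y => by
    by_contra hy
    have := hFb _ hy
    rw [hFG] at this
    exact this ⟨y, rfl⟩
  choose a ha using hFc
  choose b hb using hGc
  refine ⟨IsometryEquiv.mk' a b (fun y => ?_) fun x y => ?_⟩
  · apply Completion.coe_injective
    rw [ha, hb, hFG]
  · rw [← Completion.coe_isometry.edist_eq, ha, ha, hFi.edist_eq, Completion.coe_isometry.edist_eq]

/-- The metric on isometry classes induced by `ghbDist`. -/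
@[reducible]
def classMetric : MetricSpace IsometryClass.{u} :=
  letI : EMetricSpace IsometryClass.{u} :=
    { edist := Quotient.lift₂ (fun X Y => ghbDist X.carrier Y.carrier) (by
        have key : ∀ X X' Y : Space.{u}, X ≈ X' →
            ghbDist X.carrier Y.carrier ≤ ghbDist X'.carrier Y.carrier := by
          rintro X X' Y ⟨e⟩
          refine (ghbDist_triangle (Y := X'.carrier)).trans ?_
          rw [ghbDist_eq_zero_of_isometryEquiv e, zero_add]
        have key' : ∀ X X' Y : Space.{u}, X ≈ X' →
            ghbDist X.carrier Y.carrier = ghbDist X'.carrier Y.carrier := fun X X' Y h =>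
          le_antisymm (key _ _ _ h) (key _ _ _ (Setoid.symm h))
        intro X Y X' Y' hX hY
        rw [key' _ _ _ hX, ghbDist_comm, key' _ _ _ hY, ghbDist_comm])
      edist_self := by
        rintro ⟨X⟩
        exact ghbDist_eq_zero_of_isometryEquiv (IsometryEquiv.refl _)
      edist_comm := by
        rintro ⟨X⟩ ⟨Y⟩
        exact ghbDist_comm
      edist_triangle := by
        rintro ⟨X⟩ ⟨Y⟩ ⟨V⟩
        exact ghbDist_triangle
      eq_of_edist_eq_zero := by
        rintro ⟨X⟩ ⟨Y⟩ h
        exact Quotient.sound (nonempty_isometryEquiv_of_ghbDist_eq_zero X Y h) }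
  EMetricSpace.toMetricSpace (by
    rintro ⟨X⟩ ⟨Y⟩
    exact ghbDist_ne_top X Y)

attribute [local instance] classMetric

theorem edist_toClass (X Y : Space.{u}) :
    edist X.toClass Y.toClass = ghbDist X.carrier Y.carrier := rfl

/-! ### The metric space of isometry classes is not complete -/

section NotComplete

/-- The open interval `(0, r)` of length `r > 0`, as a noncomplete precompact locally compact
space in an arbitrary universe. -/
def intervalSpace (r : ℝ) (hr : 0 < r) : Space.{u} where
  carrier := ULift.{u} (Ioo (0 : ℝ) r)
  prop := by
    have hι : Isometry (fun x : ULift.{u} (Ioo (0 : ℝ) r) => (x.down : ℝ)) := fun _ _ => rfl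
    have hrange : range (fun x : ULift.{u} (Ioo (0 : ℝ) r) => (x.down : ℝ)) = Ioo 0 r := by
      ext t
      exact ⟨fun ⟨x, hx⟩ => hx ▸ x.down.2, fun ht => ⟨⟨⟨t, ht⟩⟩, rfl⟩⟩
    refine ⟨fun _ => ?_, ?_, ?_⟩
    · have h := hι.isClosedEmbedding.isClosed_range.closure_eq
      rw [hrange, closure_Ioo hr.ne] at h
      have h0 : (0 : ℝ) ∈ Ioo 0 r := h ▸ left_mem_Icc.2 hr.le
      exact lt_irrefl _ h0.1
    · exact (totallyBounded_preimage hι.isUniformInducing (totallyBounded_Ioo (0 : ℝ) r)).subset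
        fun x _ => x.down.2
    · refine hι.isEmbedding.isInducing.locallyCompactSpace ?_
      rw [hrange]
      exact isOpen_Ioo.isLocallyClosed

theorem edist_completion_intervalSpace_le (r : ℝ) (hr : 0 < r)
    (p q : Completion (intervalSpace.{u} r hr).carrier) : edist p q ≤ ENNReal.ofReal r := by
  induction p, q using Completion.induction_on₂ with
  | hp => exact isClosed_le continuous_edist continuous_const
  | ih x y =>
    rw [Completion.coe_isometry.edist_eq, edist_dist]
    refine ENNReal.ofReal_le_ofReal ?_
    change |(x.down : ℝ) - y.down| ≤ r
    have hx := x.down.2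
    have hy := y.down.2
    rw [abs_le]
    constructor <;> linarith [hx.1, hx.2, hy.1, hy.2]

/-- Shrinking intervals form a Cauchy sequence. The completion of a limit would be a single point,
so the limit itself would be complete. -/
theorem not_completeSpace_isometryClass : ¬ CompleteSpace IsometryClass.{u} := by
  intro _
  have hr : ∀ n : ℕ, 0 < 1 / ((n : ℝ) + 1) := fun n => by positivity
  set I : ℕ → Space.{u} := fun n => intervalSpace (1 / ((n : ℝ) + 1)) (hr n)
  have hI : ∀ N n, N ≤ n → ∀ p q : Completion (I n).carrier,
      edist p q ≤ ENNReal.ofReal (1 / ((N : ℝ) + 1)) := fun N n h p q =>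
    (edist_completion_intervalSpace_le _ _ p q).trans
      (ENNReal.ofReal_le_ofReal (Nat.one_div_le_one_div h))
  have hlim : Tendsto (fun N : ℕ => ENNReal.ofReal (1 / ((N : ℝ) + 1))) atTop (𝓝 0) := by
    simpa using ENNReal.tendsto_ofReal tendsto_one_div_add_atTop_nhds_zero_nat
  have hcau : CauchySeq fun n => (I n).toClass := by
    rw [EMetric.cauchySeq_iff]
    intro ε hε
    have h4 : Tendsto (fun N : ℕ => 4 * ENNReal.ofReal (1 / ((N : ℝ) + 1))) atTop (𝓝 0) := by
      simpa using ENNReal.Tendsto.const_mul hlim (Or.inr (by simp : (4 : ℝ≥0∞) ≠ ∞))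
    obtain ⟨N, hN⟩ := (h4.eventually_lt_const hε).exists
    refine ⟨N, fun m hm n hn => lt_of_le_of_lt ?_ hN⟩
    rw [edist_toClass]
    exact ghbDist_le_of_edist_le (hI N m hm) (hI N n hn) (I m).boundary_nonempty
      (I n).boundary_nonempty
  obtain ⟨c, hc⟩ := cauchySeq_tendsto_of_complete hcau
  obtain ⟨X, rfl⟩ : ∃ X : Space.{u}, X.toClass = c := Quotient.exists_rep c
  refine X.prop.not_complete ?_
  suffices h : Subsingleton X.carrier from inferInstance
  refine ⟨fun x y => edist_eq_zero.1 (le_antisymm ?_ zero_le)⟩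
  rw [← Completion.coe_isometry.edist_eq]
  have hd : Tendsto (fun n => edist (I n).toClass X.toClass) atTop (𝓝 0) :=
    tendsto_iff_edist_tendsto_0.1 hc
  refine le_of_forall_gt_imp_ge_of_dense fun ε hε => ?_
  have hε3 : 0 < ε / 3 := ENNReal.div_pos hε.ne' (by simp)
  obtain ⟨n, h1, h2⟩ := ((hd.eventually_lt_const hε3).and (hlim.eventually_lt_const hε3)).exists
  rw [edist_comm, edist_toClass] at h1
  obtain ⟨Z, _, φ, ψ, hφ, hψ, h⟩ := exists_of_ghbDist_lt h1
  obtain ⟨a, ha, -⟩ := exists_approx h (x : Completion X.carrier)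
  obtain ⟨b, hb, -⟩ := exists_approx h (y : Completion X.carrier)
  rw [← hφ.edist_eq]
  refine (edist_triangle4 _ (ψ a) (ψ b) _).trans ?_
  rw [hψ.edist_eq, edist_comm (ψ b), ← ENNReal.add_thirds ε]
  exact add_le_add (add_le_add ha ((hI n n le_rfl a b).trans h2.le)) hb

end NotComplete

/-! ### Parametrization of uniform curves proportional to arc length -/

section Arc

/-- A uniform arc in terms of a parametrization proportional to arc length: `c` maps `[0, 1]` to
`S` with Lipschitz constant `L`, and the lengths of the two subarcs at time `s` are replaced by
their upper bounds `L * s` and `L * (1 - s)`. The ambient set `S` and the boundary `B` are arbitrary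
subsets of a metric space, so that arcs can be transported and limits of arcs can be taken. -/
structure IsUniformArc {W : Type*} [MetricSpace W] (A L : ℝ) (S B : Set W) (c : ℝ → W) (x y : W) :
    Prop where
  mem : ∀ s ∈ Icc (0 : ℝ) 1, c s ∈ S
  dist_le : ∀ s ∈ Icc (0 : ℝ) 1, ∀ t ∈ Icc (0 : ℝ) 1, dist (c s) (c t) ≤ L * |s - t|
  source : c 0 = x
  target : c 1 = y
  length_le : L ≤ A * dist x y
  min_le : ∀ s ∈ Icc (0 : ℝ) 1, min (L * s) (L * (1 - s)) ≤ A * infDist (c s) B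

variable {W W' : Type*} [MetricSpace W] [MetricSpace W'] {A L : ℝ} {S B : Set W} {c : ℝ → W}
  {x y : W}

theorem IsUniformArc.dist_le_length (h : IsUniformArc A L S B c x y) : dist x y ≤ L := by
  have := h.dist_le 0 (by simp) 1 (by simp)
  rw [h.source, h.target] at this
  simpa using this

theorem IsUniformArc.length_nonneg (h : IsUniformArc A L S B c x y) : 0 ≤ L :=
  dist_nonneg.trans h.dist_le_length

theorem IsUniformArc.image (h : IsUniformArc A L S B c x y) {φ : W → W'} (hφ : Isometry φ) :
    IsUniformArc A L (φ '' S) (φ '' B) (φ ∘ c) (φ x) (φ y) where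
  mem s hs := mem_image_of_mem _ (h.mem s hs)
  dist_le s hs t ht := by simpa [hφ.dist_eq] using h.dist_le s hs t ht
  source := congrArg φ h.source
  target := congrArg φ h.target
  length_le := by simpa [hφ.dist_eq] using h.length_le
  min_le s hs := by simpa [infDist_image hφ] using h.min_le s hs

/-- A uniform arc whose end points are not in `B` avoids `B`: at a time where it meets `B` one of its
subarcs would have length zero. -/
theorem IsUniformArc.notMem (h : IsUniformArc A L S B c x y) (hx : x ∉ B) (hy : y ∉ B) {s : ℝ}
    (hs : s ∈ Icc (0 : ℝ) 1) : c s ∉ B := by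
  intro hB
  have h1 := h.min_le s hs
  rw [infDist_zero_of_mem hB, mul_zero] at h1
  have hx' : c s ≠ c 0 := fun he => hx (by rw [← h.source, ← he]; exact hB)
  have hy' : c s ≠ c 1 := fun he => hy (by rw [← h.target, ← he]; exact hB)
  have h2 := h.dist_le s hs 0 (by simp)
  have h3 := h.dist_le s hs 1 (by simp)
  rw [sub_zero, abs_of_nonneg hs.1] at h2
  rw [abs_sub_comm, abs_of_nonneg (sub_nonneg.2 hs.2)] at h3
  rcases min_le_iff.1 h1 with h1 | h1
  · exact hx' (dist_le_zero.1 (h2.trans h1))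
  · exact hy' (dist_le_zero.1 (h3.trans h1))

variable {X : Type u} [MetricSpace X]

theorem toReal_eVariationOn_add {γ : ℝ → X} (hγ : BoundedVariationOn γ (Icc 0 1)) {a b d : ℝ}
    (ha : 0 ≤ a) (hab : a ≤ b) (hbd : b ≤ d) (hd : d ≤ 1) :
    (eVariationOn γ (Icc a b)).toReal + (eVariationOn γ (Icc b d)).toReal =
      (eVariationOn γ (Icc a d)).toReal := by
  have h1 := eVariationOn.Icc_add_Icc γ (s := univ) hab hbd (mem_univ _)
  simp only [univ_inter] at h1
  rw [← h1, ENNReal.toReal_add]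
  · exact hγ.mono (Icc_subset_Icc ha (hbd.trans hd))
  · exact hγ.mono (Icc_subset_Icc (ha.trans hab) hd)

/-- The length function of a rectifiable curve is continuous. -/
theorem continuousOn_toReal_eVariationOn {γ : ℝ → X} (hγ : BoundedVariationOn γ (Icc 0 1))
    (hc : ContinuousOn γ (Icc 0 1)) :
    ContinuousOn (fun t => (eVariationOn γ (Icc 0 t)).toReal) (Icc 0 1) := by
  intro t ht
  have h1 := hγ.tendsto_eVariationOn_Icc_zero_left ((hc t ht).mono inter_subset_left)
  have h2 := hγ.tendsto_eVariationOn_Icc_zero_right t ((hc t ht).mono inter_subset_left)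
  have h3 := ((ENNReal.tendsto_toReal ENNReal.zero_ne_top).comp h1).add
    ((ENNReal.tendsto_toReal ENNReal.zero_ne_top).comp h2)
  simp only [ENNReal.toReal_zero, add_zero] at h3
  rw [ContinuousWithinAt, tendsto_iff_dist_tendsto_zero]
  refine squeeze_zero' (Eventually.of_forall fun _ => dist_nonneg) ?_ h3
  filter_upwards [self_mem_nhdsWithin] with s hs
  simp only [Function.comp]
  rw [Real.dist_eq]
  rcases le_total s t with hst | hst
  · rw [← toReal_eVariationOn_add hγ le_rfl hs.1 hst ht.2, sub_add_cancel_left, abs_neg,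
      abs_of_nonneg ENNReal.toReal_nonneg,
      inter_eq_self_of_subset_right (Icc_subset_Icc hs.1 ht.2)]
    exact le_add_of_nonneg_right ENNReal.toReal_nonneg
  · rw [← toReal_eVariationOn_add hγ le_rfl ht.1 hst hs.2, add_sub_cancel_left,
      abs_of_nonneg ENNReal.toReal_nonneg,
      inter_eq_self_of_subset_right (Icc_subset_Icc ht.1 hs.2)]
    exact le_add_of_nonneg_left ENNReal.toReal_nonneg

theorem IsUniformCurve.exists_isUniformArc (hX : ¬ CompleteSpace X) (hA : 0 ≤ A) {γ : ℝ → X}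
    {x y : X} (h : IsUniformCurve A γ x y) :
    ∃ (L : ℝ) (c : ℝ → Completion X), IsUniformArc A L (copy X) (boundary X) c x y := by
  have hγ : BoundedVariationOn γ (Icc 0 1) :=
    ne_top_of_le_ne_top ENNReal.ofReal_ne_top h.length_le
  set V : ℝ → ℝ := fun t => (eVariationOn γ (Icc 0 t)).toReal with hV
  have hV0 : V 0 = 0 := by simp [hV, eVariationOn.subsingleton]
  have hVsub : ∀ s t, 0 ≤ s → s ≤ t → t ≤ 1 →
      (eVariationOn γ (Icc s t)).toReal = V t - V s := fun s t hs hst ht => by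
    rw [eq_sub_iff_add_eq', toReal_eVariationOn_add hγ le_rfl hs hst ht]
  have hdist : ∀ s t, 0 ≤ s → s ≤ t → t ≤ 1 → dist (γ s) (γ t) ≤ V t - V s :=
    fun s t hs hst ht => by
      rw [← hVsub s t hs hst ht]
      exact BoundedVariationOn.dist_le (hγ.mono (Icc_subset_Icc hs ht)) (left_mem_Icc.2 hst)
        (right_mem_Icc.2 hst)
  -- A right inverse `T` of `V`, up to the factor `V 1`, need not be continuous, but `γ ∘ T` is
  -- Lipschitz, since `γ` is constant where `V` is.
  have hT : ∀ s ∈ Icc (0 : ℝ) 1, ∃ t ∈ Icc (0 : ℝ) 1, V t = V 1 * s := by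
    intro s hs
    have h1 := intermediate_value_Icc zero_le_one (continuousOn_toReal_eVariationOn hγ
      h.isCurve.continuousOn)
    refine h1 ⟨?_, ?_⟩
    · change V 0 ≤ _
      rw [hV0]
      exact mul_nonneg ENNReal.toReal_nonneg hs.1
    · exact mul_le_of_le_one_right ENNReal.toReal_nonneg hs.2
  choose! T hT hVT using hT
  have h0 : (0 : ℝ) ∈ Icc (0 : ℝ) 1 := by simp
  have h1 : (1 : ℝ) ∈ Icc (0 : ℝ) 1 := by simp
  refine ⟨V 1, fun s => (γ (T s) : Completion X), fun s _ => mem_range_self _, ?_, ?_, ?_, ?_, ?_⟩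
  · have key : ∀ s ∈ Icc (0 : ℝ) 1, ∀ t ∈ Icc (0 : ℝ) 1, T s ≤ T t →
        dist (γ (T s)) (γ (T t)) ≤ V 1 * |s - t| := fun s hs t ht hst => by
      refine (hdist _ _ (hT s hs).1 hst (hT t ht).2).trans ?_
      rw [hVT s hs, hVT t ht, ← mul_sub, abs_sub_comm]
      exact mul_le_mul_of_nonneg_left (le_abs_self _) ENNReal.toReal_nonneg
    intro s hs t ht
    rw [Completion.dist_eq]
    rcases le_total (T s) (T t) with hst | hst
    · exact key s hs t ht hst
    · rw [dist_comm, abs_sub_comm]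
      exact key t ht s hs hst
  · have := hdist 0 (T 0) le_rfl (hT 0 h0).1 (hT 0 h0).2
    rw [hVT 0 h0, hV0, mul_zero, sub_zero] at this
    change (γ (T 0) : Completion X) = x
    rw [← dist_le_zero.1 this, h.isCurve.source]
  · have := hdist (T 1) 1 (hT 1 h1).1 (hT 1 h1).2 le_rfl
    rw [hVT 1 h1, mul_one, sub_self] at this
    change (γ (T 1) : Completion X) = y
    rw [dist_le_zero.1 this, h.isCurve.target]
  · rw [Completion.dist_eq]
    exact ENNReal.toReal_le_of_le_ofReal (mul_nonneg hA dist_nonneg) h.length_le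
  · intro s hs
    have hm := h.min_length_le (T s) (hT s hs)
    have hfin : ENNReal.ofReal A * infEDist (γ (T s) : Completion X) (boundary X) ≠ ∞ :=
      ENNReal.mul_ne_top ENNReal.ofReal_ne_top (infEDist_boundary_ne_top hX _)
    have hr := ENNReal.toReal_mono hfin hm
    have hl1 : length γ 0 (T s) ≠ ∞ := hγ.mono (Icc_subset_Icc le_rfl (hT s hs).2)
    have hl2 : length γ (T s) 1 ≠ ∞ := hγ.mono (Icc_subset_Icc (hT s hs).1 le_rfl)
    rw [ENNReal.toReal_min hl1 hl2, ENNReal.toReal_mul, ENNReal.toReal_ofReal hA, length, length,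
      hVsub _ _ (hT s hs).1 (hT s hs).2 le_rfl] at hr
    change min (V (T s)) _ ≤ _ at hr
    rw [hVT s hs] at hr
    rwa [mul_sub, mul_one]

/-- The variation of a Lipschitz curve is at most the Lipschitz constant times the length of the
interval. -/
theorem eVariationOn_le_of_dist_le {γ : ℝ → X} {a b : ℝ} (hL : 0 ≤ L)
    (h : ∀ s ∈ Icc a b, ∀ t ∈ Icc a b, dist (γ s) (γ t) ≤ L * |s - t|) :
    eVariationOn γ (Icc a b) ≤ ENNReal.ofReal (L * (b - a)) := by
  rcases lt_or_ge b a with hab | hab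
  · rw [Icc_eq_empty hab.not_ge, eVariationOn.subsingleton _ subsingleton_empty]
    exact zero_le
  · have hLip : LipschitzOnWith L.toNNReal γ (Icc a b) := LipschitzOnWith.of_dist_le_mul
      fun s hs t ht => by rw [Real.coe_toNNReal _ hL, Real.dist_eq]; exact h s hs t ht
    have h1 := hLip.comp_eVariationOn_le (g := id) (mapsTo_id _)
    rw [eVariationOn_id_Icc] at h1
    rw [ENNReal.ofReal_mul hL]
    exact h1

/-- A uniform arc in the image of `X` and its boundary under an isometric embedding comes from a
uniform curve in `X`. -/
theorem IsUniformArc.exists_isUniformCurve (hX : ¬ CompleteSpace X) (hA : 0 ≤ A) {ι : X → W}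
    {x y : X} (hι : Isometry ι) (hS : S ⊆ range ι ∪ B) (hdisj : Disjoint (range ι) B)
    (hB : ∀ z : X, infDist (ι z) B = infDist (z : Completion X) (boundary X))
    (h : IsUniformArc A L S B c (ι x) (ι y)) : ∃ γ : ℝ → X, IsUniformCurve A γ x y := by
  have hmem : ∀ s ∈ Icc (0 : ℝ) 1, ∃ z, ι z = c s := fun s hs =>
    (hS (h.mem s hs)).resolve_right (h.notMem (disjoint_left.1 hdisj (mem_range_self x))
      (disjoint_left.1 hdisj (mem_range_self y)) hs)
  have : Nonempty X := ⟨x⟩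
  choose! γ hγ using hmem
  have h0 : (0 : ℝ) ∈ Icc (0 : ℝ) 1 := by simp
  have h1 : (1 : ℝ) ∈ Icc (0 : ℝ) 1 := by simp
  have hL := h.length_nonneg
  have hd : ∀ s ∈ Icc (0 : ℝ) 1, ∀ t ∈ Icc (0 : ℝ) 1, dist (γ s) (γ t) ≤ L * |s - t| :=
    fun s hs t ht => by
      rw [← hι.dist_eq, hγ s hs, hγ t ht]
      exact h.dist_le s hs t ht
  have hlen : ∀ a b, 0 ≤ a → b ≤ 1 → length γ a b ≤ ENNReal.ofReal (L * (b - a)) :=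
    fun a b ha hb => eVariationOn_le_of_dist_le hL fun s hs t ht =>
      hd s (Icc_subset_Icc ha hb hs) t (Icc_subset_Icc ha hb ht)
  refine ⟨γ, ⟨?_, ?_, ?_⟩, ?_, ?_⟩
  · have hLip : LipschitzOnWith L.toNNReal γ (Icc 0 1) := LipschitzOnWith.of_dist_le_mul
      fun s hs t ht => by rw [Real.coe_toNNReal _ hL, Real.dist_eq]; exact hd s hs t ht
    exact hLip.continuousOn
  · exact hι.injective (by rw [hγ 0 h0, h.source])
  · exact hι.injective (by rw [hγ 1 h1, h.target])
  · refine (hlen 0 1 le_rfl le_rfl).trans (ENNReal.ofReal_le_ofReal ?_)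
    have := h.length_le
    rw [hι.dist_eq] at this
    linarith
  · intro t ht
    have hm := h.min_le t ht
    rw [← hγ t ht, hB] at hm
    have hfin := infEDist_boundary_ne_top hX (γ t : Completion X)
    calc min (length γ 0 t) (length γ t 1)
        ≤ min (ENNReal.ofReal (L * t)) (ENNReal.ofReal (L * (1 - t))) := by
          refine min_le_min ?_ (hlen t 1 ht.1 le_rfl)
          simpa using hlen 0 t le_rfl ht.2
      _ = ENNReal.ofReal (min (L * t) (L * (1 - t))) :=
          ((ENNReal.ofReal_mono).map_min).symm
      _ ≤ ENNReal.ofReal (A * infDist (γ t : Completion X) (boundary X)) :=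
          ENNReal.ofReal_le_ofReal hm
      _ = _ := by rw [ENNReal.ofReal_mul hA, infDist, ENNReal.ofReal_toReal hfin]

end Arc

/-! ### Bounded uniform spaces are precompact -/

section Precompact

variable {W : Type*} [MetricSpace W] {A L R : ℝ} {S B : Set W} {c : ℝ → W} {x y : W}

theorem totallyBounded_of_forall_exists_near {s : Set W}
    (h : ∀ ε > 0, ∃ t : Set W, TotallyBounded t ∧ ∀ z ∈ s, ∃ w ∈ t, dist z w < ε) :
    TotallyBounded s := by
  rw [Metric.totallyBounded_iff]
  intro ε hε
  obtain ⟨t, ht, hst⟩ := h (ε / 2) (half_pos hε)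
  obtain ⟨F, hF, htF⟩ := Metric.totallyBounded_iff.1 ht (ε / 2) (half_pos hε)
  refine ⟨F, hF, fun z hz => ?_⟩
  obtain ⟨w, hw, hzw⟩ := hst z hz
  obtain ⟨v, hv, hwv⟩ := mem_iUnion₂.1 (htF hw)
  refine mem_iUnion₂.2 ⟨v, hv, ?_⟩
  rw [mem_ball] at hwv ⊢
  linarith [dist_triangle z w v]

/-- The points reached at time `r` by curves of speed at most one that start at `x₀` and keep
distance at least `δ` from `B`. -/
def reachable (B : Set W) (δ : ℝ) (x₀ : W) (r : ℝ) : Set W :=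
  {z | ∃ c : ℝ → W, LipschitzWith 1 c ∧ c 0 = x₀ ∧ (∀ t, δ ≤ infDist (c t) B) ∧ c r = z}

theorem exists_mem_reachable_near {δ : ℝ} {x₀ z : W} {r : ℝ} (hz : z ∈ reachable B δ x₀ r) (r' : ℝ) :
    ∃ w ∈ reachable B δ x₀ r', dist z w ≤ |r - r'| := by
  obtain ⟨c, hc, h0, hδ, rfl⟩ := hz
  refine ⟨c r', ⟨c, hc, h0, hδ, rfl⟩, ?_⟩
  simpa [Real.dist_eq] using hc.dist_le_mul r r'

/-- A Hopf–Rinow argument: the times at which the reachable set is totally bounded form a closed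
set, since reachable sets vary continuously, and an open set, since the closure of the reachable set
is a compact subset of the locally compact complement of `B`. -/
theorem totallyBounded_reachable [CompleteSpace W]
    (hloc : ∀ Q : Set W, IsCompact Q → Disjoint Q B → ∃ η > 0, TotallyBounded (thickening η Q))
    {δ : ℝ} (hδ : 0 < δ) (x₀ : W) {M : ℝ} (hM : 0 ≤ M) :
    TotallyBounded (reachable B δ x₀ M) := by
  have key : Icc 0 M ⊆ {r | TotallyBounded (reachable B δ x₀ r)} := by
    refine IsClosed.Icc_subset_of_forall_exists_gt ?_ ?_ ?_
    · refine isClosed_of_closure_subset fun r hr => ?_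
      refine ⟨?_, closure_minimal inter_subset_right isClosed_Icc hr⟩
      refine totallyBounded_of_forall_exists_near fun ε hε => ?_
      obtain ⟨r', hr', hd⟩ := Metric.mem_closure_iff.1 hr ε hε
      refine ⟨_, hr'.1, fun z hz => ?_⟩
      obtain ⟨w, hw, hzw⟩ := exists_mem_reachable_near hz r'
      exact ⟨w, hw, hzw.trans_lt (by rwa [Real.dist_eq] at hd)⟩
    · refine (finite_singleton x₀).totallyBounded.subset ?_
      rintro z ⟨c, -, h0, -, rfl⟩
      exact h0
    · rintro r ⟨hr, hr0⟩ y hy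
      have hcomp : IsCompact (closure (reachable B δ x₀ r)) :=
        isCompact_iff_totallyBounded_isComplete.2 ⟨hr.closure, isClosed_closure.isComplete⟩
      have hsub : closure (reachable B δ x₀ r) ⊆ {z | δ ≤ infDist z B} := by
        refine closure_minimal ?_ (isClosed_le continuous_const (continuous_infDist_pt B))
        rintro z ⟨c, -, -, hc, rfl⟩
        exact hc r
      obtain ⟨η, hη, hTB⟩ := hloc _ hcomp (disjoint_left.2 fun z hz hzB => by
        have := hsub hz
        rw [mem_ofPred_eq, infDist_zero_of_mem hzB] at this
        exact hδ.not_ge this)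
      have hy' : r < y := hy
      have hpos : 0 < min (η / 2) (y - r) := lt_min (half_pos hη) (sub_pos.2 hy')
      refine ⟨r + min (η / 2) (y - r), hTB.subset fun z hz => ?_, by linarith, ?_⟩
      · obtain ⟨w, hw, hzw⟩ := exists_mem_reachable_near hz r
        refine mem_thickening_iff.2 ⟨w, subset_closure hw, hzw.trans_lt ?_⟩
        rw [add_sub_cancel_left, abs_of_pos hpos]
        linarith [min_le_left (η / 2) (y - r)]
      · linarith [min_le_right (η / 2) (y - r)]
  exact key (right_mem_Icc.2 hM)

/-- A uniform arc between points far from the boundary stays away from the boundary. -/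
theorem IsUniformArc.le_infDist (h : IsUniformArc A L S B c x y) (hA : 0 < A) {ε : ℝ}
    (hx : ε ≤ infDist x B) (hy : ε ≤ infDist y B) {s : ℝ} (hs : s ∈ Icc (0 : ℝ) 1) :
    min (ε / 2) (ε / (2 * A)) ≤ infDist (c s) B := by
  have h2 := h.dist_le 0 (by simp) s hs
  have h3 := h.dist_le 1 (by simp) s hs
  rw [h.source, zero_sub, abs_neg, abs_of_nonneg hs.1] at h2
  rw [h.target, abs_of_nonneg (sub_nonneg.2 hs.2)] at h3
  have h4 := infDist_le_infDist_add_dist (s := B) (x := x) (y := c s)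
  have h5 := infDist_le_infDist_add_dist (s := B) (x := y) (y := c s)
  have h6 := h.min_le s hs
  -- Either the point is at arc length at least `ε / 2` from both ends, or it is close to one of them.
  by_cases hc : ε / 2 ≤ min (L * s) (L * (1 - s))
  · refine (min_le_right _ _).trans ?_
    rw [div_le_iff₀ (by positivity)]
    linarith
  · refine (min_le_left _ _).trans ?_
    rw [not_le, min_lt_iff] at hc
    rcases hc with hc | hc <;> linarith

theorem IsUniformArc.mem_reachable (h : IsUniformArc A L S B c x y) {δ M : ℝ} (hM : 0 < M)
    (hLM : L ≤ M) (hδ : ∀ s ∈ Icc (0 : ℝ) 1, δ ≤ infDist (c s) B) : y ∈ reachable B δ x M := by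
  refine ⟨fun t => c (projIcc 0 1 zero_le_one (t / M)), ?_, ?_, fun t => hδ _ (Subtype.prop _), ?_⟩
  · refine LipschitzWith.of_dist_le_mul fun s t => ?_
    have h1 := h.dist_le _ (projIcc (0 : ℝ) 1 zero_le_one (s / M)).2 _
      (projIcc (0 : ℝ) 1 zero_le_one (t / M)).2
    have h2 : |(projIcc (0 : ℝ) 1 zero_le_one (s / M) : ℝ) - projIcc (0 : ℝ) 1 zero_le_one (t / M)|
        ≤ |s / M - t / M| := by
      have := (LipschitzWith.projIcc (zero_le_one (α := ℝ))).dist_le_mul (s / M) (t / M)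
      rwa [NNReal.coe_one, one_mul, Subtype.dist_eq, Real.dist_eq, Real.dist_eq] at this
    refine h1.trans ?_
    calc L * _ ≤ M * |s / M - t / M| := by gcongr
      _ = _ := by
        rw [← sub_div, abs_div, abs_of_pos hM, mul_div_cancel₀ _ hM.ne', NNReal.coe_one, one_mul,
          Real.dist_eq]
  · simp [h.source]
  · simp [div_self hM.ne', h.target]

/-- Following a uniform arc from `x` for the length `A * ε` leads to a point at distance at
least `ε` from the boundary. -/
theorem IsUniformArc.exists_le_infDist (h : IsUniformArc A L S B c x y) (hA : 0 < A) {ε : ℝ}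
    (hε : 0 < ε) (hxy : 2 * (A * ε) ≤ dist x y) :
    ∃ q ∈ S, ε ≤ infDist q B ∧ dist x q ≤ A * ε := by
  have hAε : 0 < A * ε := mul_pos hA hε
  have hL2 : 2 * (A * ε) ≤ L := hxy.trans h.dist_le_length
  have hL : 0 < L := by linarith
  have hs : A * ε / L ∈ Icc (0 : ℝ) 1 := ⟨by positivity, by rw [div_le_one hL]; linarith⟩
  have hLs : L * (A * ε / L) = A * ε := mul_div_cancel₀ _ hL.ne'
  refine ⟨c (A * ε / L), h.mem _ hs, ?_, ?_⟩
  · have h1 := h.min_le _ hs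
    rw [mul_sub, mul_one, hLs, min_eq_left (by linarith)] at h1
    exact le_of_mul_le_mul_left h1 hA
  · have h1 := h.dist_le 0 (by simp) _ hs
    rwa [h.source, zero_sub, abs_neg, abs_of_nonneg hs.1, hLs] at h1

/-- One of the two ends of a pair at distance at least `R / 2` is remote from any given point. -/
theorem exists_quarter_le_dist (hS : ∃ a ∈ S, ∃ b ∈ S, R / 2 ≤ dist a b) (x : W) :
    ∃ y ∈ S, R / 4 ≤ dist x y := by
  obtain ⟨a, ha, b, hb, hab⟩ := hS
  by_contra! hcon
  linarith [hcon a ha, hcon b hb, dist_triangle_left a b x]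

/-- Any two points of `S` are joined by a uniform arc, and `S` is not too small: then every point of
`S` is near points at a definite distance from the boundary. -/
theorem exists_le_infDist_of_forall_isUniformArc (hA : 0 < A)
    (harc : ∀ x ∈ S, ∀ y ∈ S, ∃ L c, IsUniformArc A L S B c x y)
    (hS : ∃ a ∈ S, ∃ b ∈ S, R / 2 ≤ dist a b) {ε : ℝ} (hε : 0 < ε) (hεR : 8 * (A * ε) ≤ R)
    (hx : x ∈ S) : ∃ q ∈ S, ε ≤ infDist q B ∧ dist x q ≤ A * ε := by
  obtain ⟨y, hy, hxy⟩ := exists_quarter_le_dist hS x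
  obtain ⟨L, c, hc⟩ := harc x hx y hy
  exact hc.exists_le_infDist hA hε (by linarith)

theorem exists_half_le_dist_of_le_diam {T : Type*} [MetricSpace T] (hR : 0 < R)
    (h : R ≤ diam (univ : Set T)) : ∃ a b : T, R / 2 ≤ dist a b := by
  by_contra! hcon
  have := diam_le_of_forall_dist_le (s := (univ : Set T)) (half_pos hR).le
    fun a _ b _ => (hcon a b).le
  linarith

variable {X : Type u} [MetricSpace X]

theorem IsUniformSpace.exists_isUniformArc (h : IsUniformSpace A X) (hA : 0 ≤ A) :
    ∀ x ∈ copy X, ∀ y ∈ copy X, ∃ L c, IsUniformArc A L (copy X) (boundary X) c x y := by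
  rintro _ ⟨x, rfl⟩ _ ⟨y, rfl⟩
  obtain ⟨γ, hγ⟩ := h.exists_uniformCurve x y
  exact hγ.exists_isUniformArc h.not_complete hA

theorem IsBoundedUniform.exists_half_le_dist (h : IsBoundedUniform A R X) (hR : 0 < R) :
    ∃ a ∈ copy X, ∃ b ∈ copy X, R / 2 ≤ dist a b := by
  obtain ⟨a, b, hab⟩ := exists_half_le_dist_of_le_diam hR h.le_diam
  exact ⟨a, mem_range_self a, b, mem_range_self b, by rwa [Completion.dist_eq]⟩

theorem exists_totallyBounded_thickening [LocallyCompactSpace X] {Q : Set (Completion X)}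
    (hQ : IsCompact Q) (hdisj : Disjoint Q (boundary X)) :
    ∃ η > 0, TotallyBounded (thickening η Q) := by
  have hemb : IsOpenEmbedding ((↑) : X → Completion X) :=
    ⟨(Completion.isUniformEmbedding_coe X).isEmbedding, isOpen_copy⟩
  have hQr : Q ⊆ copy X := fun z hz => not_notMem.1 (disjoint_left.1 hdisj hz)
  obtain ⟨K, hK, hQK⟩ := exists_compact_superset (hemb.isInducing.isCompact_preimage' hQ hQr)
  have hQU : Q ⊆ (↑) '' interior K := fun z hz => by
    obtain ⟨w, rfl⟩ := hQr hz
    exact mem_image_of_mem _ (hQK hz)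
  obtain ⟨η, hη, hsub⟩ := hQ.exists_thickening_subset_open (hemb.isOpenMap _ isOpen_interior) hQU
  exact ⟨η, hη, (hK.image (Completion.continuous_coe X)).totallyBounded.subset
    (hsub.trans (image_mono interior_subset))⟩

theorem IsBoundedUniform.totallyBounded (h : IsBoundedUniform A R X) (hA : 0 < A) (hR : 0 < R) :
    TotallyBounded (univ : Set X) := by
  have := h.isUniformSpace.locallyCompact
  have harc := h.isUniformSpace.exists_isUniformArc hA.le
  suffices hcopy : TotallyBounded (copy X) from
    (totallyBounded_preimage (Completion.isUniformEmbedding_coe X).isUniformInducing hcopy).subset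
      fun x _ => mem_range_self (f := ((↑) : X → Completion X)) x
  obtain ⟨D, hD0, hD⟩ : ∃ D > 0, ∀ x ∈ copy X, ∀ y ∈ copy X, dist x y ≤ D := by
    obtain ⟨D, hD⟩ := isBounded_iff.1 h.bounded
    refine ⟨max D 1, by positivity, ?_⟩
    rintro _ ⟨x, rfl⟩ _ ⟨y, rfl⟩
    rw [Completion.dist_eq]
    exact (hD (mem_univ x) (mem_univ y)).trans (le_max_left _ _)
  have hfar : ∀ ε > 0, TotallyBounded {p ∈ copy X | ε ≤ infDist p (boundary X)} := by
    intro ε hε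
    rcases eq_empty_or_nonempty {p ∈ copy X | ε ≤ infDist p (boundary X)} with he | ⟨x₀, hx₀, hx₀ε⟩
    · rw [he]; exact totallyBounded_empty
    · have hδ : 0 < min (ε / 2) (ε / (2 * A)) := by positivity
      have hM : 0 < A * D := by positivity
      refine (totallyBounded_reachable (fun Q hQ hd => exists_totallyBounded_thickening hQ hd) hδ
        x₀ hM.le).subset ?_
      rintro p ⟨hp, hpε⟩
      obtain ⟨L, c, hc⟩ := harc x₀ hx₀ p hp
      refine hc.mem_reachable hM ?_ fun s hs => hc.le_infDist hA hx₀ε hpε hs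
      exact hc.length_le.trans (mul_le_mul_of_nonneg_left (hD _ hx₀ _ hp) hA.le)
  refine totallyBounded_of_forall_exists_near fun η hη => ?_
  -- The first bound leaves room for an arc of length `2 * A * ε`, the second one gives `A * ε < η`.
  have hε : 0 < min (R / (8 * A)) (η / (2 * A)) := by positivity
  refine ⟨_, hfar _ hε, fun x hx => ?_⟩
  obtain ⟨q, hq, hqε, hd⟩ := exists_le_infDist_of_forall_isUniformArc hA harc
    (h.exists_half_le_dist hR) hε (by
      have := mul_le_mul_of_nonneg_left (min_le_left (R / (8 * A)) (η / (2 * A))) hA.le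
      have h2 : A * (R / (8 * A)) = R / 8 := by field_simp
      linarith) hx
  refine ⟨q, ⟨hq, hqε⟩, hd.trans_lt ?_⟩
  have := mul_le_mul_of_nonneg_left (min_le_right (R / (8 * A)) (η / (2 * A))) hA.le
  have h2 : A * (η / (2 * A)) = η / 2 := by field_simp
  linarith

theorem IsBoundedUniform.isNoncompletePrecompactLocallyCompact (h : IsBoundedUniform A R X)
    (hA : 0 < A) (hR : 0 < R) : IsNoncompletePrecompactLocallyCompact X :=
  ⟨h.isUniformSpace.not_complete, h.totallyBounded hA hR, h.isUniformSpace.locallyCompact⟩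

end Precompact

/-! ### Limits of uniform arcs -/

section Limit

variable {W : Type*} [MetricSpace W] {A R : ℝ} {U : Ultrafilter ℕ} {O Bd : ℕ → Set W} {K B : Set W}

theorem exists_tendsto_of_mem (hK : IsCompact K)
    (hO : Tendsto (fun n => hausdorffEDist (O n) K) U (𝓝 0)) {w : ℕ → W} (hw : ∀ n, w n ∈ O n) :
    ∃ a ∈ K, Tendsto w U (𝓝 a) := by
  have h1 : Tendsto (fun n => infEDist (w n) K) U (𝓝 0) :=
    tendsto_of_tendsto_of_tendsto_of_le_of_le tendsto_const_nhds hO (fun _ => zero_le)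
      fun n => infEDist_le_hausdorffEDist_of_mem (hw n)
  have hKne : K.Nonempty := by
    obtain ⟨n, hn⟩ := (h1.eventually_lt_const ENNReal.zero_lt_top).exists
    by_contra hne
    rw [not_nonempty_iff_eq_empty.1 hne, infEDist_empty] at hn
    exact lt_irrefl _ hn
  choose k hk hkd using fun n => hK.exists_infEDist_eq_edist hKne (w n)
  obtain ⟨a, ha, hka⟩ := hK.ultrafilter_le_nhds (U.map k)
    (tendsto_principal.2 (Eventually.of_forall hk))
  refine ⟨a, ha, tendsto_iff_edist_tendsto_0.2 ?_⟩
  have h2 : Tendsto (fun n => edist (k n) a) U (𝓝 0) := tendsto_iff_edist_tendsto_0.1 hka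
  have h3 := h1.add h2
  rw [add_zero] at h3
  refine tendsto_of_tendsto_of_tendsto_of_le_of_le tendsto_const_nhds h3 (fun _ => zero_le)
    fun n => ?_
  simp only [hkd]
  exact edist_triangle _ _ _

theorem exists_mem_tendsto (hU : (U : Filter ℕ) ≤ atTop) (hOne : ∀ n, (O n).Nonempty)
    (hO : Tendsto (fun n => hausdorffEDist (O n) K) U (𝓝 0)) {x : W} (hx : x ∈ K) :
    ∃ w : ℕ → W, (∀ n, w n ∈ O n) ∧ Tendsto w U (𝓝 x) := by
  have hδ : Tendsto (fun n : ℕ => ((n : ℝ≥0∞) + 1)⁻¹) U (𝓝 0) := by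
    have := (tendsto_add_atTop_iff_nat 1).2 ENNReal.tendsto_inv_nat_nhds_zero
    exact Tendsto.mono_left (by simpa using this) hU
  have h1 : ∀ n, infEDist x (O n) < infEDist x (O n) + ((n : ℝ≥0∞) + 1)⁻¹ := fun n =>
    ENNReal.lt_add_right (infEDist_ne_top (hOne n)) (by simp)
  choose w hw hwd using fun n => infEDist_lt_iff.1 (h1 n)
  refine ⟨w, hw, tendsto_iff_edist_tendsto_0.2 ?_⟩
  have h2 := hO.add hδ
  rw [add_zero] at h2
  refine tendsto_of_tendsto_of_tendsto_of_le_of_le tendsto_const_nhds h2 (fun _ => zero_le)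
    fun n => ?_
  rw [edist_comm]
  refine (hwd n).le.trans (add_le_add ?_ le_rfl)
  rw [hausdorffEDist_comm]
  exact infEDist_le_hausdorffEDist_of_mem hx

/-- The pointwise limit along an ultrafilter of uniform arcs parametrized proportionally to arc
length is a uniform arc with the same constant. -/
theorem exists_isUniformArc_limit (hU : (U : Filter ℕ) ≤ atTop) (hA : 0 ≤ A) (hK : IsCompact K)
    (hOne : ∀ n, (O n).Nonempty)
    (hO : Tendsto (fun n => hausdorffEDist (O n) K) U (𝓝 0))
    (hB : Tendsto (fun n => hausdorffEDist (Bd n) B) U (𝓝 0))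
    (harc : ∀ n, ∀ x ∈ O n, ∀ y ∈ O n, ∃ L c, IsUniformArc A L (O n) (Bd n) c x y)
    {x y : W} (hx : x ∈ K) (hy : y ∈ K) : ∃ L c, IsUniformArc A L K B c x y := by
  obtain ⟨a, ha, hax⟩ := exists_mem_tendsto hU hOne hO hx
  obtain ⟨b, hb, hby⟩ := exists_mem_tendsto hU hOne hO hy
  choose L c hc using fun n => harc n (a n) (ha n) (b n) (hb n)
  have hab : Tendsto (fun n => A * dist (a n) (b n)) U (𝓝 (A * dist x y)) :=
    (hax.dist hby).const_mul A
  obtain ⟨ℓ, -, hℓ⟩ : ∃ ℓ ∈ Icc 0 (A * dist x y + 1), Tendsto L U (𝓝 ℓ) := by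
    obtain ⟨ℓ, h1, h2⟩ := (isCompact_Icc (a := (0 : ℝ)) (b := A * dist x y + 1)).ultrafilter_le_nhds
      (U.map L) (tendsto_principal.2 (by
        have h3 : ∀ᶠ n in (U : Filter ℕ), A * dist (a n) (b n) < A * dist x y + 1 :=
          hab.eventually_lt_const (by linarith)
        filter_upwards [h3] with n hn
        exact ⟨(hc n).length_nonneg, (hc n).length_le.trans hn.le⟩))
    exact ⟨ℓ, h1, h2⟩
  have hlim : ∀ s ∈ Icc (0 : ℝ) 1, ∃ z ∈ K, Tendsto (fun n => c n s) U (𝓝 z) := fun s hs =>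
    exists_tendsto_of_mem hK hO fun n => (hc n).mem s hs
  have : Nonempty W := ⟨x⟩
  choose! γ hγK hγ using hlim
  refine ⟨ℓ, γ, hγK, fun s hs t ht => ?_, ?_, ?_, ?_, fun s hs => ?_⟩
  · exact le_of_tendsto_of_tendsto' ((hγ s hs).dist (hγ t ht)) (hℓ.mul_const _)
      fun n => (hc n).dist_le s hs t ht
  · have h0 := hγ 0 (by simp)
    simp only [(hc _).source] at h0
    exact tendsto_nhds_unique h0 hax
  · have h1 := hγ 1 (by simp)
    simp only [(hc _).target] at h1
    exact tendsto_nhds_unique h1 hby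
  · exact le_of_tendsto_of_tendsto' hℓ hab fun n => (hc n).length_le
  · have h1 : Tendsto (fun n => min (L n * s) (L n * (1 - s))) U
        (𝓝 (min (ℓ * s) (ℓ * (1 - s)))) := (hℓ.mul_const _).min (hℓ.mul_const _)
    have h2 : Tendsto (fun n => A * (infDist (γ s) B + hausdorffDist B (Bd n) + dist (c n s) (γ s)))
        U (𝓝 (A * infDist (γ s) B)) := by
      have h3 : Tendsto (fun n => hausdorffDist B (Bd n)) U (𝓝 0) := by
        simp_rw [hausdorffDist_comm (s := B)]
        exact (ENNReal.tendsto_toReal ENNReal.zero_ne_top).comp hB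
      simpa using (((tendsto_const_nhds (x := infDist (γ s) B)).add h3).add
        (tendsto_iff_dist_tendsto_zero.1 (hγ s hs))).const_mul A
    refine le_of_tendsto_of_tendsto h1 h2 ?_
    filter_upwards [hB.eventually_lt_const ENNReal.zero_lt_top] with n hn
    rw [hausdorffEDist_comm] at hn
    refine ((hc n).min_le s hs).trans (mul_le_mul_of_nonneg_left ?_ hA)
    exact infDist_le_infDist_add_dist.trans
      (add_le_add (infDist_le_infDist_add_hausdorffDist hn.ne) le_rfl)

theorem exists_le_dist_limit (hK : IsCompact K)
    (hO : Tendsto (fun n => hausdorffEDist (O n) K) U (𝓝 0)) {r : ℝ}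
    (h : ∀ n, ∃ a ∈ O n, ∃ b ∈ O n, r ≤ dist a b) : ∃ a ∈ K, ∃ b ∈ K, r ≤ dist a b := by
  choose a ha b hb hab using h
  obtain ⟨x, hx, hax⟩ := exists_tendsto_of_mem hK hO ha
  obtain ⟨y, hy, hby⟩ := exists_tendsto_of_mem hK hO hb
  exact ⟨x, hx, y, hy, ge_of_tendsto' (hax.dist hby) hab⟩

end Limit

/-! ### The limit space -/

section LimitSpace

variable {W : Type u} [MetricSpace W] {A R : ℝ} {K B : Set W}

/-- If any two points of a compact set `K` are joined by a uniform arc with respect to `B`, then the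
points outside `B` are dense in `K`. -/
theorem closure_diff_eq (hA : 0 < A) (hR : 0 < R) (hK : IsCompact K)
    (harc : ∀ x ∈ K, ∀ y ∈ K, ∃ L c, IsUniformArc A L K B c x y)
    (hdiam : ∃ a ∈ K, ∃ b ∈ K, R / 2 ≤ dist a b) : closure (K \ B) = K := by
  refine subset_antisymm (closure_minimal sdiff_subset hK.isClosed) fun x hx => ?_
  rw [Metric.mem_closure_iff]
  intro η hη
  -- The first bound leaves room for an arc of length `2 * A * ε`, the second one gives `A * ε < η`.
  have hε : 0 < min (R / (8 * A)) (η / (2 * A)) := by positivity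
  obtain ⟨q, hq, hqε, hd⟩ := exists_le_infDist_of_forall_isUniformArc hA harc hdiam hε (by
      have := mul_le_mul_of_nonneg_left (min_le_left (R / (8 * A)) (η / (2 * A))) hA.le
      have h2 : A * (R / (8 * A)) = R / 8 := by field_simp
      linarith) hx
  refine ⟨q, ⟨hq, fun hqB => ?_⟩, hd.trans_lt ?_⟩
  · rw [infDist_zero_of_mem hqB] at hqε
    exact hε.not_ge hqε
  · have := mul_le_mul_of_nonneg_left (min_le_right (R / (8 * A)) (η / (2 * A))) hA.le
    have h2 : A * (η / (2 * A)) = η / 2 := by field_simp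
    linarith

/-- The complement of `B` in a compact set `K` all of whose points are joined by uniform arcs is a
bounded uniform space with completion `K` and boundary `B`. -/
theorem exists_space_of_isUniformArc [CompleteSpace W] (hA : 0 < A) (hR : 0 < R) (hK : IsCompact K)
    (hB : IsClosed B) (hBK : B ⊆ K) (hBne : B.Nonempty)
    (harc : ∀ x ∈ K, ∀ y ∈ K, ∃ L c, IsUniformArc A L K B c x y)
    (hdiam : ∃ a ∈ K, ∃ b ∈ K, R / 2 ≤ dist a b) (hRK : R ≤ diam K) :
    ∃ (Y : Space.{u}) (ψ : Completion Y.carrier → W), IsBoundedUniform A R Y.carrier ∧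
      Isometry ψ ∧ closure (ψ '' copy Y.carrier) = K ∧ ψ '' boundary Y.carrier = B := by
  have hcl := closure_diff_eq hA hR hK harc hdiam
  have hι : Isometry (Subtype.val : ↥(K \ B) → W) := isometry_subtype_coe
  have hrange : range (Subtype.val : ↥(K \ B) → W) = K \ B := Subtype.range_coe
  obtain ⟨ψ, hψ, hψc, hcopy, hbd⟩ := exists_isometry_completion hι
  rw [hrange] at hcopy hbd
  rw [hcl, sdiff_sdiff_right_self, inter_eq_self_of_subset_right hBK] at hbd
  have hnc : ¬ CompleteSpace ↥(K \ B) := fun h => by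
    have h1 := (completeSpace_coe_iff_isComplete.1 h).isClosed.closure_eq
    rw [hcl] at h1
    obtain ⟨z, hz⟩ := hBne
    have h2 := hBK hz
    rw [h1] at h2
    exact h2.2 hz
  have hlc : LocallyCompactSpace ↥(K \ B) := by
    have : CompactSpace K := isCompact_iff_compactSpace.1 hK
    have hinc : IsInducing (inclusion (sdiff_subset : K \ B ⊆ K)) :=
      (IsEmbedding.inclusion sdiff_subset).isInducing
    refine hinc.locallyCompactSpace (IsOpen.isLocallyClosed ?_)
    rw [range_inclusion]
    have : {x : K | (x : W) ∈ K \ B} = Subtype.val ⁻¹' Bᶜ := by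
      ext x
      simp
    rw [this]
    exact hB.isOpen_compl.preimage continuous_subtype_val
  have htb : TotallyBounded (univ : Set ↥(K \ B)) :=
    (totallyBounded_preimage hι.isUniformInducing hK.totallyBounded).subset fun x _ => x.2.1
  have hcurve : ∀ x y : ↥(K \ B), ∃ γ : ℝ → ↥(K \ B), IsUniformCurve A γ x y := fun x y => by
    obtain ⟨L, c, hc⟩ := harc x x.2.1 y y.2.1
    refine hc.exists_isUniformCurve hnc hA.le hι ?_ ?_ fun z => ?_
    · rw [hrange, sdiff_union_self]
      exact subset_union_left
    · rw [hrange]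
      exact disjoint_sdiff_left
    · have hz := infDist_image hψ (x := (z : Completion ↥(K \ B))) (t := boundary ↥(K \ B))
      rwa [hψc, hbd] at hz
  refine ⟨⟨↥(K \ B), ⟨hnc, htb, hlc⟩⟩, ψ, ⟨⟨hlc, fun x y => ?_, hnc, hcurve⟩, ?_, ?_⟩, hψ, ?_, hbd⟩
  · obtain ⟨γ, hγ⟩ := hcurve x y
    exact ⟨γ, hγ.isCurve, hγ.length_le.trans_lt ENNReal.ofReal_lt_top⟩
  · exact htb.isBounded
  · rw [← hι.diam_image, image_univ, hrange, ← diam_closure, hcl]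
    exact hRK
  · rw [hcopy, hcl]

end LimitSpace

/-! ### Successive gluing of a sequence of spaces -/

section Gluing

/-- A metric space with an isometric copy of `P`. -/
structure Extension (P : Type u) [MetricSpace P] : Type (u + 1) where
  carrier : Type u
  [metric : MetricSpace carrier]
  embed : P → carrier
  isometry_embed : Isometry embed

attribute [instance] Extension.metric

variable {P Z : ℕ → Type u} [∀ n, MetricSpace (P n)] [∀ n, Nonempty (P n)] [∀ n, MetricSpace (Z n)]
  {f : ∀ n, P n → Z n} {g : ∀ n, P (n + 1) → Z n}

/-- Given spaces `Z n` that contain copies of `P n` and `P (n + 1)`, the space obtained by gluing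
`Z 0`, ..., `Z (n - 1)` along these copies, with its copy of `P n`. -/
def gluedExtension (hf : ∀ n, Isometry (f n)) (hg : ∀ n, Isometry (g n)) :
    ∀ n, Extension (P n)
  | 0 => ⟨P 0, id, isometry_id⟩
  | n + 1 =>
    { carrier := GlueSpace (gluedExtension hf hg n).isometry_embed (hf n)
      embed := toGlueR (gluedExtension hf hg n).isometry_embed (hf n) ∘ g n
      isometry_embed := (toGlueR_isometry _ _).comp (hg n) }

/-- All the spaces `Z n` embed compatibly into a single complete space. -/
theorem exists_common_extension (hf : ∀ n, Isometry (f n)) (hg : ∀ n, Isometry (g n)) :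
    ∃ (W : Type u) (_ : MetricSpace W) (Φ : ∀ n, P n → W), CompleteSpace W ∧
      (∀ n, Isometry (Φ n)) ∧
      ∀ n, ∃ h : Z n → W, Isometry h ∧ h ∘ f n = Φ n ∧ h ∘ g n = Φ (n + 1) := by
  let V := gluedExtension hf hg
  let j : ∀ n, (V n).carrier → (V (n + 1)).carrier := fun n =>
    toGlueL (V n).isometry_embed (hf n)
  have hj : ∀ n, Isometry (j n) := fun n => toGlueL_isometry (V n).isometry_embed (hf n)
  let k : ∀ n, Z n → (V (n + 1)).carrier := fun n => toGlueR (V n).isometry_embed (hf n)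
  have hk : ∀ n, Isometry (k n) := fun n => toGlueR_isometry (V n).isometry_embed (hf n)
  have hjk : ∀ n, j n ∘ (V n).embed = k n ∘ f n := fun n =>
    toGlue_commute (V n).isometry_embed (hf n)
  have hkg : ∀ n, k n ∘ g n = (V (n + 1)).embed := fun n => rfl
  let ι : ∀ n, (V n).carrier → Completion (InductiveLimit hj) := fun n x =>
    (toInductiveLimit hj n x : InductiveLimit hj)
  have hι : ∀ n, Isometry (ι n) := fun n =>
    Completion.coe_isometry.comp (toInductiveLimit_isometry hj n)
  have hιj : ∀ n, ι (n + 1) ∘ j n = ι n := fun n =>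
    congrArg (((↑) : InductiveLimit hj → Completion (InductiveLimit hj)) ∘ ·)
      (toInductiveLimit_commute hj n)
  refine ⟨Completion (InductiveLimit hj), inferInstance, fun n => ι n ∘ (V n).embed, inferInstance,
    fun n => (hι n).comp (V n).isometry_embed, fun n => ⟨ι (n + 1) ∘ k n, (hι _).comp (hk n), ?_, ?_⟩⟩
  · rw [Function.comp_assoc, ← hjk, ← Function.comp_assoc, hιj]
  · rw [Function.comp_assoc, hkg]

/-- A sequence of spaces with summable successive distances can be realized in one complete
space. -/
theorem exists_common_space (X : ℕ → Space.{u}) {d : ℕ → ℝ≥0∞}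
    (h : ∀ n, ghbDist (X n).carrier (X (n + 1)).carrier < d n) :
    ∃ (W : Type u) (_ : MetricSpace W) (Φ : ∀ n, Completion (X n).carrier → W), CompleteSpace W ∧
      (∀ n, Isometry (Φ n)) ∧ ∀ n,
        hausdorffEDist (Φ n '' copy (X n).carrier) (Φ (n + 1) '' copy (X (n + 1)).carrier) +
          hausdorffEDist (Φ n '' boundary (X n).carrier)
            (Φ (n + 1) '' boundary (X (n + 1)).carrier) < d n := by
  choose Z _ φ ψ hφ hψ hd using fun n => exists_of_ghbDist_lt (h n)
  obtain ⟨W, _, Φ, hW, hΦ, hcomp⟩ := exists_common_extension hφ hψ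
  refine ⟨W, _, Φ, hW, hΦ, fun n => ?_⟩
  obtain ⟨k, hk, h1, h2⟩ := hcomp n
  rw [← h1, ← h2]
  simp only [image_comp, hausdorffEDist_image hk]
  exact hd n

end Gluing

/-! ### Completeness of the class of bounded uniform spaces -/

theorem exists_tendsto_hausdorffEDist {W : Type*} [MetricSpace W] [CompleteSpace W] {S : ℕ → Set W}
    (hS : ∀ n, IsCompact (S n)) (hne : ∀ n, (S n).Nonempty)
    (h : ∀ n, hausdorffEDist (S n) (S (n + 1)) ≤ 1 / 2 ^ n) :
    ∃ K : Set W, IsCompact K ∧ K.Nonempty ∧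
      Tendsto (fun n => hausdorffEDist (S n) K) atTop (𝓝 0) := by
  let T : ℕ → TopologicalSpace.NonemptyCompacts W := fun n => ⟨⟨S n, hS n⟩, hne n⟩
  have hT : CauchySeq T := cauchySeq_of_edist_le_geometric_two 1 ENNReal.one_ne_top h
  obtain ⟨K, hK⟩ := cauchySeq_tendsto_of_complete hT
  exact ⟨K, K.isCompact, K.nonempty, tendsto_iff_edist_tendsto_0.1 hK⟩

theorem subset_of_tendsto_hausdorffEDist {W : Type*} [MetricSpace W] {S T : ℕ → Set W} {K B : Set W}
    (hK : IsClosed K) (hTS : ∀ n, T n ⊆ S n)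
    (hS : Tendsto (fun n => hausdorffEDist (S n) K) atTop (𝓝 0))
    (hT : Tendsto (fun n => hausdorffEDist (T n) B) atTop (𝓝 0)) : B ⊆ K := by
  intro x hx
  rw [mem_iff_infEDist_zero_of_closed hK]
  have h0 := hT.add hS
  rw [add_zero] at h0
  refine le_antisymm (ge_of_tendsto' h0 fun n => ?_) zero_le
  calc infEDist x K ≤ infEDist x (S n) + hausdorffEDist (S n) K :=
        infEDist_le_infEDist_add_hausdorffEDist
    _ ≤ hausdorffEDist (T n) B + hausdorffEDist (S n) K := by
        gcongr
        rw [hausdorffEDist_comm]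
        exact (infEDist_anti (hTS n)).trans (infEDist_le_hausdorffEDist_of_mem hx)

/-- A sequence of bounded uniform spaces with rapidly decreasing successive distances converges to
a bounded uniform space. -/
theorem exists_tendsto_of_ghbDist_lt {A R : ℝ} (hA : 0 < A) (hR : 0 < R) (X : ℕ → Space.{u})
    (hX : ∀ n, IsBoundedUniform A R (X n).carrier)
    (h : ∀ n, ghbDist (X n).carrier (X (n + 1)).carrier < 1 / 2 ^ n) :
    ∃ Y : Space.{u}, IsBoundedUniform A R Y.carrier ∧
      Tendsto (fun n => ghbDist (X n).carrier Y.carrier) atTop (𝓝 0) := by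
  obtain ⟨W, _, Φ, _, hΦ, hd⟩ := exists_common_space X h
  have hcl : ∀ n, closure (Φ n '' copy (X n).carrier) = range (Φ n) := fun n => by
    rw [copy, (hΦ n).isClosedEmbedding.closure_image_eq, Completion.denseRange_coe.closure_range,
      image_univ]
  obtain ⟨K, hKc, -, hK⟩ := exists_tendsto_hausdorffEDist (S := fun n => range (Φ n))
    (fun n => isCompact_range (hΦ n).continuous) (fun n => range_nonempty _) fun n => by
      rw [← hcl, ← hcl, hausdorffEDist_closure]
      exact le_self_add.trans (hd n).le
  obtain ⟨B, hBc, hBne, hB⟩ := exists_tendsto_hausdorffEDist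
    (S := fun n => Φ n '' boundary (X n).carrier)
    (fun n => isClosed_boundary.isCompact.image (hΦ n).continuous)
    (fun n => (X n).boundary_nonempty.image _) fun n => le_add_self.trans (hd n).le
  have hO : Tendsto (fun n => hausdorffEDist (Φ n '' copy (X n).carrier) K) atTop (𝓝 0) := by
    simpa only [← hcl, hausdorffEDist_closure_left] using hK
  have hBK : B ⊆ K :=
    subset_of_tendsto_hausdorffEDist hKc.isClosed (fun n => image_subset_range _ _) hK hB
  let U : Ultrafilter ℕ := Ultrafilter.of atTop
  have hU : (U : Filter ℕ) ≤ atTop := Ultrafilter.of_le _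
  have harcX : ∀ n, ∀ x ∈ Φ n '' copy (X n).carrier, ∀ y ∈ Φ n '' copy (X n).carrier,
      ∃ L c, IsUniformArc A L (Φ n '' copy (X n).carrier) (Φ n '' boundary (X n).carrier) c x y := by
    rintro n _ ⟨x, hx, rfl⟩ _ ⟨y, hy, rfl⟩
    obtain ⟨L, c, hc⟩ := (hX n).isUniformSpace.exists_isUniformArc hA.le x hx y hy
    exact ⟨L, _, hc.image (hΦ n)⟩
  have harc : ∀ x ∈ K, ∀ y ∈ K, ∃ L c, IsUniformArc A L K B c x y := fun x hx y hy =>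
    exists_isUniformArc_limit hU hA.le hKc (fun n => (X n).copy_nonempty.image _) (hO.mono_left hU)
      (hB.mono_left hU) harcX hx hy
  have hdist : ∀ r, 0 < r → r < R → ∃ a ∈ K, ∃ b ∈ K, r ≤ dist a b := fun r hr0 hr =>
    exists_le_dist_limit hKc (hO.mono_left hU) fun n => by
      by_contra! hcon
      have := diam_le_of_forall_dist_le (s := (univ : Set (X n).carrier)) hr0.le fun a _ b _ => by
        have := hcon _ (mem_image_of_mem (Φ n) (mem_range_self a)) _
          (mem_image_of_mem (Φ n) (mem_range_self b))
        rw [(hΦ n).dist_eq, Completion.dist_eq] at this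
        exact this.le
      linarith [(hX n).le_diam]
  have hRK : R ≤ diam K := by
    refine le_of_forall_lt_imp_le_of_dense fun r hr => ?_
    rcases le_or_gt r 0 with hr0 | hr0
    · exact hr0.trans diam_nonneg
    · obtain ⟨a, ha, b, hb, hab⟩ := hdist r hr0 hr
      exact hab.trans (dist_le_diam_of_mem hKc.isBounded ha hb)
  obtain ⟨Y, ψ, hY, hψ, hcopy, hbd⟩ := exists_space_of_isUniformArc hA hR hKc hBc.isClosed hBK hBne
    harc (hdist _ (half_pos hR) (half_lt_self hR)) hRK
  refine ⟨Y, hY, ?_⟩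
  have hlim := hO.add hB
  rw [add_zero] at hlim
  refine tendsto_of_tendsto_of_tendsto_of_le_of_le tendsto_const_nhds hlim (fun _ => zero_le)
    fun n => ?_
  refine (ghbDist_le (hΦ n) hψ).trans_eq ?_
  rw [hbd, ← hausdorffEDist_closure_right (t := ψ '' copy Y.carrier), hcopy]

theorem isComplete_uniformClass {A R : ℝ} (hA : 0 < A) (hR : 0 < R) :
    IsComplete (uniformClass.{u} A R) := by
  rw [← completeSpace_coe_iff_isComplete]
  refine EMetric.complete_of_convergent_controlled_sequences (fun n => 1 / 2 ^ n)
    (fun n => by simp) fun u hu => ?_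
  choose X hXu hX using fun n => (u n).2
  obtain ⟨Y, hY, hlim⟩ := exists_tendsto_of_ghbDist_lt hA hR X hX fun n => by
    rw [← edist_toClass, hXu, hXu]
    exact hu n n (n + 1) le_rfl n.le_succ
  refine ⟨⟨Y.toClass, Y, rfl, hY⟩, tendsto_iff_edist_tendsto_0.2 ?_⟩
  change Tendsto (fun n => edist (u n : IsometryClass.{u}) Y.toClass) atTop (𝓝 0)
  simpa only [← edist_toClass, hXu] using hlim

end GHB

end

theorem theorem1p1 :
    ∃ m : MetricSpace GHB.IsometryClass.{u},
      (∀ X Y : GHB.Space.{u}, edist X.toClass Y.toClass = GHB.ghbDist X.carrier Y.carrier) ∧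
      ¬ CompleteSpace GHB.IsometryClass.{u} ∧
      ∀ A R : ℝ, 0 < A → 0 < R →
        (∀ (X : Type u) [MetricSpace X], GHB.IsBoundedUniform A R X →
          GHB.IsNoncompletePrecompactLocallyCompact X) ∧
        IsComplete (GHB.uniformClass.{u} A R) :=
  ⟨GHB.classMetric, GHB.edist_toClass, GHB.not_completeSpace_isometryClass, fun _ _ hA hR =>
    ⟨fun _ _ h => h.isNoncompletePrecompactLocallyCompact hA hR,
      GHB.isComplete_uniformClass hA hR⟩⟩
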